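/- For a finite non-abelian group $G$ let $b(G)$ be the largest degree of a complex irreducible character of $G$, let $c(G)$ be the smallest degree of a nonlinear (that is, of degree greater than $1$) complex irreducible character of $G$, and put $\mathrm{rat}(G)=b(G)/c(G)$; for a finite abelian group put $c(G)=1$ and $\mathrm{rat}(G)=1$. Let $q\ge 5$ be a prime power, let $S=\mathrm{PSL}_2(q)$, and let $G$ be a finite group with a minimal normal subgroup $N$ that is isomorphic to $S^k=S\times\cdots\times S$, a direct product of $k$ copies of $S$. Then $$k<\ln(\mathrm{rat}(G))+1.3 .$$ Moreover, $kq$ and $q^k$ are both degrees of complex irreducible characters of $G$. -/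

import Mathlib

namespace CharacterDegreeRatio

/-- `N` is a minimal normal subgroup of `G`: a nontrivial normal subgroup of `G` that
contains no normal subgroup of `G` other than itself and the trivial one. -/
def IsMinimalNormal {G : Type*} [Group G] (N : Subgroup G) : Prop :=
  N.Normal ∧ N ≠ ⊥ ∧ ∀ M : Subgroup G, M.Normal → M ≤ N → M = ⊥ ∨ M = N

/-- `d` is the degree of an ordinary irreducible character of `G`, that is, `G` has an
irreducible complex representation of dimension `d`. -/
def IsCharacterDegree (G : Type*) [Group G] (d : ℕ) : Prop :=
  ∃ ρ : Representation ℂ G (Fin d → ℂ), ρ.IsIrreducible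

/-- A character degree of a finite group is at most the order of the group; so the supremum
in the definition of `maxDegree` below is a maximum. -/
theorem IsCharacterDegree.le_card {G : Type*} [Group G] [Finite G] {d : ℕ}
    (h : IsCharacterDegree G d) : d ≤ Nat.card G := by
  obtain ⟨ρ, hρ⟩ := h
  have hne : ∃ v : Fin d → ℂ, v ≠ 0 := by
    by_contra! hv
    obtain ⟨a, b, hab⟩ := hρ.toNontrivial
    apply hab
    apply SetLike.ext
    intro x
    rw [hv x]
    exact ⟨fun _ => b.toSubmodule.zero_mem, fun _ => a.toSubmodule.zero_mem⟩
  obtain ⟨v, hv⟩ := hne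
  let W : Subrepresentation ρ :=
    { toSubmodule := Submodule.span ℂ (Set.range fun g => ρ g v)
      apply_mem_toSubmodule := by
        intro g x hx
        induction hx using Submodule.span_induction with
        | mem x hx =>
          obtain ⟨h, rfl⟩ := hx
          refine Submodule.subset_span ⟨g * h, ?_⟩
          simp
        | zero => simp
        | add x y _ _ hx hy => rw [map_add]; exact Submodule.add_mem _ hx hy
        | smul c x _ hx => rw [map_smul]; exact Submodule.smul_mem _ c hx }
  have hvW : v ∈ W.toSubmodule := Submodule.subset_span ⟨1, by simp⟩
  have hW : W.toSubmodule = ⊤ := by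
    rcases hρ.eq_bot_or_eq_top W with h | h
    · rw [h] at hvW
      exact absurd ((Submodule.mem_bot ℂ).1 hvW) hv
    · rw [h]; rfl
  have := Fintype.ofFinite G
  have key := finrank_range_le_card (R := ℂ) (fun g => ρ g v)
  have h2 : Submodule.span ℂ (Set.range fun g => ρ g v) = ⊤ := hW
  rw [Set.finrank, h2, finrank_top, Module.finrank_fin_fun] at key
  rwa [Nat.card_eq_fintype_card]

/-- `b(G)`: the largest degree of an irreducible character of the finite group `G`. -/
noncomputable def maxDegree (G : Type*) [Group G] : ℕ :=
  sSup {d : ℕ | IsCharacterDegree G d}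

open Classical in
/-- `c(G)`: the smallest degree of a nonlinear irreducible character of the finite group `G`,
with the convention `c(G) = 1` if `G` is abelian. -/
noncomputable def minNonlinearDegree (G : Type*) [Group G] : ℕ :=
  if ∀ x y : G, x * y = y * x then 1 else sInf {d : ℕ | IsCharacterDegree G d ∧ 1 < d}

open Classical in
/-- `rat(G) = b(G) / c(G)`, the character degree ratio of the finite group `G`, with the
convention `rat(G) = 1` if `G` is abelian. -/
noncomputable def rat (G : Type*) [Group G] : ℝ :=
  if ∀ x y : G, x * y = y * x then 1 else (maxDegree G : ℝ) / (minNonlinearDegree G : ℝ)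

end CharacterDegreeRatio

/-! Let $p$ be the characteristic of the field. The Sylow $p$-subgroups of $S$ correspond to the
$q+1$ points of the projective line, so $S$ permutes them doubly transitively. A Sylow $p$-subgroup
of $S^k$ is a $k$-tuple of those of $S$. Since conjugation gives a map $G\to\mathrm{Aut}(S^k)$, $G$
acts on $P^k$ with $P=\mathrm{Syl}_p(S)$. Using Sylow subgroups instead of points gives this action
without any description of $\mathrm{Aut}(S)$.

The functions on $P$ split as $1\oplus\mathrm{St}$ with $\dim\mathrm{St}=q$, so the functions on
$P^k$ form $(1\oplus\mathrm{St})^{\otimes k}$. Two summands are $G$-invariant because $G$ acts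
through a wreath product: sums of sum-zero functions of one coordinate (dimension $kq$) and
$\mathrm{St}^{\otimes k}$ (dimension $q^k$). Both are irreducible by
`isCharacterDegree_of_spherical`: a function in either that is fixed by a point stabiliser and
vanishes at that point is zero. For the first summand this needs $G$ to permute the factors
transitively, which is minimality of $N$.

Hence $\mathrm{rat}(G)\ge q^k/(kq)\ge 5^{k-1}/k>e^{k-1.3}$. -/

open Equiv

namespace CharacterDegreeRatio

/-! ### Irreducibility inside a transitive permutation representation. -/

section PermutationRepresentation

/-- The permutation representation on the complex functions on `X`. -/
def permRep {G X : Type*} [Group G] (φ : G →* Perm X) : Representation ℂ G (X → ℂ) where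
  toFun g := LinearMap.funLeft ℂ ℂ (φ g⁻¹)
  map_one' := by ext; simp [LinearMap.funLeft]
  map_mul' g h := by ext; simp [LinearMap.funLeft]

@[simp]
theorem permRep_apply {G X : Type*} [Group G] (φ : G →* Perm X) (g : G) (f : X → ℂ) (x : X) :
    permRep φ g f x = f (φ g⁻¹ x) := rfl

/-- A minimal nonzero invariant subspace of dimension `d` makes `d` a character degree. -/
theorem isCharacterDegree_of_minimal {G V : Type*} [Group G] [AddCommGroup V] [Module ℂ V]
    [FiniteDimensional ℂ V] {ρ : Representation ℂ G V} (W : Subrepresentation ρ) {d : ℕ}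
    (hd : Module.finrank ℂ W.toSubmodule = d) (hd0 : d ≠ 0)
    (hW : ∀ U : Subrepresentation ρ, U ≤ W → U = ⊥ ∨ U = W) : IsCharacterDegree G d := by
  let e : W.toSubmodule ≃ₗ[ℂ] (Fin d → ℂ) := LinearEquiv.ofFinrankEq _ _ (by simpa using hd)
  let ρ' : Representation ℂ G (Fin d → ℂ) :=
    { toFun := fun g => e.toLinearMap ∘ₗ W.toRepresentation g ∘ₗ e.symm.toLinearMap
      map_one' := by ext; simp
      map_mul' := fun g h => by ext; simp }
  have hρ' : ∀ g v, ρ' g v = e (W.toRepresentation g (e.symm v)) := fun g v => rfl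
  have : NeZero d := ⟨hd0⟩
  refine ⟨ρ', { exists_pair_ne := ⟨⊥, ⊤, fun h => ?_⟩, eq_bot_or_eq_top := fun U => ?_ }⟩
  · have h1 : (1 : Fin d → ℂ) ∈ (⊥ : Subrepresentation ρ') := by
      rw [h]; exact Submodule.mem_top (R := ℂ)
    exact one_ne_zero ((Submodule.mem_bot ℂ).1 h1)
  · let i : (Fin d → ℂ) →ₗ[ℂ] V := W.toSubmodule.subtype ∘ₗ e.symm.toLinearMap
    have hi : Function.Injective i := W.toSubmodule.injective_subtype.comp e.symm.injective
    have hig : ∀ g v, i (ρ' g v) = ρ g (i v) := by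
      intro g v
      simp only [hρ', i, LinearMap.comp_apply, LinearEquiv.coe_coe, LinearEquiv.symm_apply_apply]
      rfl
    let U' : Subrepresentation ρ :=
      { toSubmodule := U.toSubmodule.map i
        apply_mem_toSubmodule := by
          rintro g _ ⟨v, hv, rfl⟩
          exact ⟨ρ' g v, U.apply_mem_toSubmodule g hv, hig g v⟩ }
    have hU' : U' ≤ W := by
      rintro _ ⟨v, -, rfl⟩
      exact (e.symm v).2
    rcases hW U' hU' with h | h
    · left
      apply Subrepresentation.toSubmodule_injective
      have h2 : U.toSubmodule.map i = ⊥ := congrArg Subrepresentation.toSubmodule h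
      exact Submodule.map_injective_of_injective hi (by rw [h2]; exact (Submodule.map_bot i).symm)
    · right
      apply Subrepresentation.toSubmodule_injective
      refine eq_top_iff.2 fun v _ => ?_
      have h2 : i v ∈ U'.toSubmodule := by rw [h]; exact (e.symm v).2
      obtain ⟨u, hu, huv⟩ := h2
      exact hi huv ▸ hu

variable {G X : Type*} [Group G] [Finite G] {φ : G →* Perm X} {x₀ : X}

/-- A nonzero invariant space of functions on a transitive `G`-set contains a function that is
fixed by the stabiliser of a point and has the value `1` there. -/
theorem exists_spherical (htrans : ∀ x, ∃ g, φ g x₀ = x) (U : Subrepresentation (permRep φ))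
    (hU : U ≠ ⊥) :
    ∃ f ∈ U, (∀ g, φ g x₀ = x₀ → permRep φ g f = f) ∧ f x₀ = 1 := by
  obtain ⟨f, hf, hf0⟩ : ∃ f ∈ U, f ≠ 0 := by
    by_contra! h
    refine hU (Subrepresentation.toSubmodule_injective ((Submodule.eq_bot_iff _).2 h))
  obtain ⟨x, hx⟩ : ∃ x, f x ≠ 0 := by
    by_contra! h
    exact hf0 (funext h)
  obtain ⟨a, ha⟩ := htrans x
  -- Translate `f` so that it is nonzero at `x₀`, then sum over the stabiliser; the sum does not
  -- cancel at `x₀`, where all its terms agree.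
  let f₁ := permRep φ a⁻¹ f
  have hf₁ : f₁ ∈ U := U.apply_mem_toSubmodule _ hf
  have hf₁x : f₁ x₀ ≠ 0 := by simpa [f₁, ha] using hx
  let H : Subgroup G := (MulAction.stabilizer (Perm X) x₀).comap φ
  have hH : ∀ g, g ∈ H ↔ φ g x₀ = x₀ := fun g => Iff.rfl
  have := Fintype.ofFinite H
  let f₂ : X → ℂ := ∑ h : H, permRep φ h f₁
  have hf₂ : f₂ ∈ U := U.toSubmodule.sum_mem fun h _ => U.apply_mem_toSubmodule _ hf₁
  have hf₂x : f₂ x₀ = Fintype.card H * f₁ x₀ := by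
    have : ∀ h : H, permRep φ h f₁ x₀ = f₁ x₀ := by
      intro h
      rw [permRep_apply, (hH _).1 (H.inv_mem h.2)]
    simp only [f₂, Finset.sum_apply, this, Finset.sum_const, Finset.card_univ, nsmul_eq_mul]
  have hne : f₂ x₀ ≠ 0 := by
    rw [hf₂x]
    exact mul_ne_zero (Nat.cast_ne_zero.2 Fintype.card_ne_zero) hf₁x
  refine ⟨(f₂ x₀)⁻¹ • f₂, U.toSubmodule.smul_mem _ hf₂, fun g hg => ?_, ?_⟩
  · rw [map_smul]
    congr 1
    simp only [f₂, map_sum]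
    refine Fintype.sum_equiv (Equiv.mulLeft (⟨g, hg⟩ : H)) _ _ fun h => ?_
    simp
  · simp [hne]

/-- If the stabiliser of a point of a transitive `G`-set fixes, up to scalars, at most one function
of an invariant space `W`, and that function does not vanish at the point, then `W` is
irreducible. -/
theorem isCharacterDegree_of_spherical [Finite X] (htrans : ∀ x, ∃ g, φ g x₀ = x)
    (W : Subrepresentation (permRep φ))
    (hW : ∀ f ∈ W, (∀ g, φ g x₀ = x₀ → permRep φ g f = f) → f x₀ = 0 → f = 0)
    {d : ℕ} (hd : Module.finrank ℂ W.toSubmodule = d) (hd0 : d ≠ 0) : IsCharacterDegree G d := by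
  have := Fintype.ofFinite X
  have : NeZero (Nat.card G : ℂ) := ⟨Nat.cast_ne_zero.2 Nat.card_pos.ne'⟩
  refine isCharacterDegree_of_minimal W hd hd0 fun U hU => ?_
  -- Maschke's theorem. If both `U` and `U' ⊓ W` were nonzero, each would contain a stabiliser-fixed
  -- function with value `1` at `x₀`; by `hW` these coincide, although `U` and `U'` are disjoint.
  obtain ⟨U', hU'⟩ := exists_isCompl U
  by_cases hUb : U = ⊥
  · exact Or.inl hUb
  right
  by_cases hb : U' ⊓ W = ⊥
  · have hs : U.toSubmodule ⊔ (U'.toSubmodule ⊓ W.toSubmodule) = W.toSubmodule := by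
      rw [← sup_inf_assoc_of_le U'.toSubmodule (show U.toSubmodule ≤ W.toSubmodule from hU)]
      have : U.toSubmodule ⊔ U'.toSubmodule = ⊤ :=
        congrArg Subrepresentation.toSubmodule hU'.sup_eq_top
      rw [this, top_inf_eq]
    have h2 : U'.toSubmodule ⊓ W.toSubmodule = ⊥ := congrArg Subrepresentation.toSubmodule hb
    rw [h2, sup_bot_eq] at hs
    exact Subrepresentation.toSubmodule_injective hs
  · exfalso
    obtain ⟨f, hf, hfs, hf1⟩ := exists_spherical htrans U hUb
    obtain ⟨f', hf', hfs', hf1'⟩ := exists_spherical htrans (U' ⊓ W) hb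
    have h := hW (f - f') (W.toSubmodule.sub_mem (hU hf) hf'.2)
      (fun g hg => by rw [map_sub, hfs g hg, hfs' g hg]) (by simp [hf1, hf1'])
    rw [sub_eq_zero] at h
    have hmem : f ∈ U ⊓ U' := ⟨hf, h ▸ hf'.1⟩
    rw [hU'.inf_eq_bot] at hmem
    have hf0 : f = 0 := (Submodule.mem_bot ℂ).1 hmem
    rw [hf0] at hf1
    exact zero_ne_one hf1

end PermutationRepresentation

/-! ### Two irreducible constituents in the product action of a wreath product. -/

section Wreath

/-- The permutations of `ι → P` in the product action of the wreath product of the symmetric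
groups of `P` and `ι`. -/
def IsWreath {ι P : Type*} (π : Perm (ι → P)) (σ : Perm ι) : Prop :=
  ∃ τ : ι → Perm P, ∀ x i, π x (σ i) = τ i (x i)

/-- The functions on `P` with sum zero. -/
def sumZero (P : Type*) [Fintype P] : Submodule ℂ (P → ℂ) :=
  LinearMap.ker (∑ p, LinearMap.proj p : (P → ℂ) →ₗ[ℂ] ℂ)

theorem mem_sumZero {P : Type*} [Fintype P] {f : P → ℂ} : f ∈ sumZero P ↔ ∑ p, f p = 0 := by
  simp [sumZero]

theorem finrank_sumZero {P : Type*} [Fintype P] {q : ℕ} (hq : Fintype.card P = q + 1) :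
    Module.finrank ℂ (sumZero P) = q := by
  classical
  have h := LinearMap.finrank_range_add_finrank_ker (∑ p, LinearMap.proj p : (P → ℂ) →ₗ[ℂ] ℂ)
  have hs : LinearMap.range (∑ p, LinearMap.proj p : (P → ℂ) →ₗ[ℂ] ℂ) = ⊤ := by
    have : Nonempty P := Fintype.card_pos_iff.1 (by omega)
    obtain ⟨p⟩ := this
    refine LinearMap.range_eq_top.2 fun z => ⟨Pi.single p z, by simp⟩
  rw [hs, finrank_top, Module.finrank_self, Module.finrank_fintype_fun_eq_card, hq] at h
  exact Nat.add_left_cancel (h.trans (Nat.add_comm q 1))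

theorem IsWreath.apply_update {ι P : Type*} [DecidableEq ι] {π : Perm (ι → P)} {σ : Perm ι} {τ : ι → Perm P}
    (h : ∀ x i, π x (σ i) = τ i (x i)) (x : ι → P) (i : ι) (p : P) :
    π (Function.update x i p) = Function.update (π x) (σ i) (τ i p) := by
  ext j
  obtain ⟨j, rfl⟩ := σ.surjective j
  rcases eq_or_ne j i with rfl | hj
  · rw [h]; simp
  · rw [h, Function.update_of_ne hj, Function.update_of_ne (σ.injective.ne hj), h]

variable {ι P : Type*} [Fintype ι] [DecidableEq ι] [Fintype P]

/-- The function `x ↦ ∑ i, f i (x i)` on `ι → P` attached to functions `f i` with sum zero. -/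
def sumOfCoords (ι P : Type*) [Fintype ι] [Fintype P] :
    (ι → sumZero P) →ₗ[ℂ] ((ι → P) → ℂ) where
  toFun f x := ∑ i, (f i : P → ℂ) (x i)
  map_add' f g := by ext; simp [Finset.sum_add_distrib]
  map_smul' c f := by ext; simp [Finset.mul_sum]

theorem sumOfCoords_apply {ι P : Type*} [Fintype ι] [Fintype P] (f : ι → sumZero P) (x : ι → P) :
    sumOfCoords ι P f x = ∑ i, (f i : P → ℂ) (x i) := rfl

theorem sumOfCoords_update (f : ι → sumZero P) (x : ι → P) (i : ι) (p : P) :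
    sumOfCoords ι P f (Function.update x i p) =
      sumOfCoords ι P f x + ((f i : P → ℂ) p - (f i : P → ℂ) (x i)) := by
  rw [sumOfCoords_apply, sumOfCoords_apply, ← Finset.add_sum_erase _ _ (Finset.mem_univ i),
    ← Finset.add_sum_erase Finset.univ (fun j => (f j : P → ℂ) (x j)) (Finset.mem_univ i)]
  have : ∑ j ∈ Finset.univ.erase i, (f j : P → ℂ) (Function.update x i p j) =
      ∑ j ∈ Finset.univ.erase i, (f j : P → ℂ) (x j) :=
    Finset.sum_congr rfl fun j hj => by rw [Function.update_of_ne (Finset.ne_of_mem_erase hj)]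
  rw [this, Function.update_self]
  ring

theorem eq_zero_of_const_of_mem_sumZero [Nonempty P] {f : P → ℂ} (hf : f ∈ sumZero P) {c : ℂ}
    (hc : ∀ p, f p = c) : f = 0 := by
  rw [mem_sumZero] at hf
  simp only [hc, Finset.sum_const, Finset.card_univ, nsmul_eq_mul, mul_eq_zero,
    Nat.cast_eq_zero, Fintype.card_ne_zero, false_or] at hf
  exact funext fun p => by rw [hc, hf, Pi.zero_apply]

theorem sumOfCoords_injective [Nonempty P] : Function.Injective (sumOfCoords ι P) := by
  refine (injective_iff_map_eq_zero _).2 fun f hf => funext fun i => Subtype.ext ?_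
  let x : ι → P := fun _ => Classical.arbitrary P
  refine eq_zero_of_const_of_mem_sumZero (f i).2 (c := (f i : P → ℂ) (x i)) fun p => ?_
  have := sumOfCoords_update f x i p
  rw [hf] at this
  simp only [Pi.zero_apply, zero_add] at this
  exact sub_eq_zero.1 this.symm

/-- The functions on `ι → P` with sum zero on every coordinate line. -/
def lineSumZero (ι P : Type*) [DecidableEq ι] [Fintype P] : Submodule ℂ ((ι → P) → ℂ) where
  carrier := {f | ∀ x i, ∑ p, f (Function.update x i p) = 0}
  zero_mem' := by simp
  add_mem' hf hg x i := by simp [Finset.sum_add_distrib, hf x i, hg x i]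
  smul_mem' c f hf x i := by simp [← Finset.mul_sum, hf x i]

/-- A function with sum zero on lines vanishes if it vanishes at all points with no coordinate in
common with a given point. -/
theorem eq_zero_of_lineSumZero {f : (ι → P) → ℂ} (hf : f ∈ lineSumZero ι P) (x₀ : ι → P)
    (h : ∀ x, (∀ i, x i ≠ x₀ i) → f x = 0) : f = 0 := by
  classical
  suffices ∀ n : ℕ, ∀ x, (Finset.univ.filter fun i => x i = x₀ i).card = n → f x = 0 from
    funext fun x => this _ x rfl
  intro n
  induction n with
  | zero =>
    intro x hx
    refine h x fun i hi => ?_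
    have := Finset.card_eq_zero.1 hx
    exact Finset.notMem_empty i (this ▸ Finset.mem_filter.2 ⟨Finset.mem_univ i, hi⟩)
  | succ n ih =>
    intro x hx
    obtain ⟨i, hi⟩ : (Finset.univ.filter fun i => x i = x₀ i).Nonempty :=
      Finset.card_pos.1 (by omega)
    have hs := hf x i
    rw [← Finset.add_sum_erase _ _ (Finset.mem_univ (x i)), Function.update_eq_self,
      Finset.sum_eq_zero, add_zero] at hs
    · exact hs
    · intro p hp
      apply ih
      have : (Finset.univ.filter fun j => Function.update x i p j = x₀ j) =
          (Finset.univ.filter fun j => x j = x₀ j).erase i := by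
        ext j
        rcases eq_or_ne j i with rfl | hj
        · have := Finset.ne_of_mem_erase hp
          have hi := (Finset.mem_filter.1 hi).2
          simp [← hi, this]
        · simp [hj]
      rw [this, Finset.card_erase_of_mem hi, hx, Nat.add_sub_cancel]

/-- Restriction to the points with no coordinate equal to `p₀` is an isomorphism onto the functions
on a set of size `q ^ |ι|`. -/
theorem finrank_lineSumZero {q : ℕ} (hq : Fintype.card P = q + 1) :
    Module.finrank ℂ (lineSumZero ι P) = q ^ Fintype.card ι := by
  classical
  have : Nonempty P := Fintype.card_pos_iff.1 (by omega)
  obtain ⟨p₀⟩ := this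
  let Q := {p : P // p ≠ p₀}
  let r : lineSumZero ι P →ₗ[ℂ] ((ι → Q) → ℂ) :=
    LinearMap.funLeft ℂ ℂ (fun (y : ι → Q) i => (y i : P)) ∘ₗ (lineSumZero ι P).subtype
  have hr : ∀ f y, r f y = (f : (ι → P) → ℂ) (fun i => (y i : P)) := fun f y => rfl
  have hinj : Function.Injective r := by
    refine (injective_iff_map_eq_zero _).2 fun f hf => Subtype.ext ?_
    refine eq_zero_of_lineSumZero f.2 (fun _ => p₀) fun x hx => ?_
    have := congrFun hf (fun i => ⟨x i, hx i⟩)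
    rwa [hr] at this
  -- `κ · r` is the sum-zero function $\delta_r-\delta_{p_0}$; its products over the coordinates
  -- extend the delta functions on `ι → Q`.
  let κ : P → Q → ℂ := fun p r => if p = p₀ then -1 else if p = r then 1 else 0
  have hκ : ∀ s, ∑ p, κ p s = 0 := by
    intro s
    rw [← Finset.add_sum_erase _ _ (Finset.mem_univ p₀)]
    have : ∑ p ∈ Finset.univ.erase p₀, κ p s =
        ∑ p ∈ Finset.univ.erase p₀, if p = (s : P) then 1 else 0 :=
      Finset.sum_congr rfl fun p hp => if_neg (Finset.ne_of_mem_erase hp)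
    rw [this, Finset.sum_ite_eq', if_pos (Finset.mem_erase.2 ⟨s.2, Finset.mem_univ _⟩)]
    simp [κ]
  have hsurj : Function.Surjective r := by
    intro g
    refine ⟨⟨fun x => ∑ y : ι → Q, (∏ i, κ (x i) (y i)) * g y, fun x i => ?_⟩, ?_⟩
    · rw [Finset.sum_comm]
      refine Finset.sum_eq_zero fun y _ => ?_
      rw [← Finset.sum_mul]
      have : ∀ p, ∏ j, κ (Function.update x i p j) (y j) =
          κ p (y i) * ∏ j ∈ Finset.univ.erase i, κ (x j) (y j) := by
        intro p
        rw [← Finset.mul_prod_erase _ _ (Finset.mem_univ i), Function.update_self]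
        congr 1
        exact Finset.prod_congr rfl fun j hj => by
          rw [Function.update_of_ne (Finset.ne_of_mem_erase hj)]
      simp only [this]
      rw [← Finset.sum_mul, hκ, zero_mul, zero_mul]
    · ext z
      rw [hr]
      change ∑ y : ι → Q, (∏ i, κ (z i) (y i)) * g y = g z
      rw [Finset.sum_eq_single z]
      · simp [κ, (z _).2]
      · intro y _ hy
        obtain ⟨i, hi⟩ := Function.ne_iff.1 hy
        rw [Finset.prod_eq_zero (Finset.mem_univ i), zero_mul]
        have : (z i : P) ≠ y i := fun h => hi (Subtype.ext h.symm)
        simp [κ, (z i).2, this]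
      · simp
  rw [(LinearEquiv.ofBijective r ⟨hinj, hsurj⟩).finrank_eq, Module.finrank_fintype_fun_eq_card,
    Fintype.card_fun]
  congr 1
  have := Fintype.card_subtype_compl (fun p => p = p₀)
  simp only [Fintype.card_subtype_eq, hq] at this
  simpa [Q] using this

variable {G : Type*} [Group G] {φ : G →* Perm (ι → P)}

/-- `sumOfCoords` as a subrepresentation. -/
def sumOfCoordsRep (hw : ∀ g, ∃ σ, IsWreath (φ g) σ) : Subrepresentation (permRep φ) where
  toSubmodule := LinearMap.range (sumOfCoords ι P)
  apply_mem_toSubmodule := by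
    rintro g _ ⟨f, rfl⟩
    obtain ⟨σ, τ, h⟩ := hw g⁻¹
    refine ⟨fun i => ⟨(f (σ i) : P → ℂ) ∘ τ i, ?_⟩, ?_⟩
    · rw [mem_sumZero]
      exact (Equiv.sum_comp (τ i) (f (σ i) : P → ℂ)).trans (mem_sumZero.1 (f (σ i)).2)
    · ext x
      rw [permRep_apply, sumOfCoords_apply, sumOfCoords_apply, 
        ← Equiv.sum_comp σ fun i => (f i : P → ℂ) (φ g⁻¹ x i)]
      exact Finset.sum_congr rfl fun i _ => by rw [h]; rfl

/-- `lineSumZero` as a subrepresentation. -/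
def lineSumZeroRep (hw : ∀ g, ∃ σ, IsWreath (φ g) σ) : Subrepresentation (permRep φ) where
  toSubmodule := lineSumZero ι P
  apply_mem_toSubmodule := by
    intro g f hf x i
    obtain ⟨σ, τ, h⟩ := hw g⁻¹
    simp only [permRep_apply, IsWreath.apply_update h]
    rw [Equiv.sum_comp (τ i) (fun p => f (Function.update (φ g⁻¹ x) (σ i) p))]
    exact hf _ _

/-- A group that acts on `ι → P`, where `|P| = q + 1`, through the wreath product, transitively on
`ι`, and transitively on the pairs of points with given coordinates in common, has irreducible
representations of degrees `|ι| * q` and `q ^ |ι|`. -/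
theorem isCharacterDegree_of_wreath [Finite G] [Nonempty ι]
    (hw : ∀ g, ∃ σ, IsWreath (φ g) σ)
    (htrans : ∀ i j, ∃ g σ, IsWreath (φ g) σ ∧ σ i = j)
    (hpairs : ∀ x y x' y', (∀ i, x i = y i ↔ x' i = y' i) → ∃ g, φ g x = x' ∧ φ g y = y')
    {q : ℕ} (hq : Fintype.card P = q + 1) (hq0 : q ≠ 0) :
    IsCharacterDegree G (Fintype.card ι * q) ∧ IsCharacterDegree G (q ^ Fintype.card ι) := by
  classical
  have : Nonempty P := Fintype.card_pos_iff.1 (by omega)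
  obtain ⟨p₀⟩ := this
  let x₀ : ι → P := fun _ => p₀
  have ht : ∀ x, ∃ g, φ g x₀ = x := fun x =>
    (hpairs x₀ x₀ x x fun _ => Iff.intro (fun _ => rfl) fun _ => rfl).imp fun g h => h.1
  have hfix : ∀ f : (ι → P) → ℂ, (∀ g, φ g x₀ = x₀ → permRep φ g f = f) →
      ∀ g, φ g x₀ = x₀ → ∀ x, f (φ g x) = f x := by
    intro f hf g hg x
    have := congrFun (hf g hg) (φ g x)
    rw [permRep_apply] at this
    rw [← this]
    simp
  constructor
  · refine isCharacterDegree_of_spherical ht (sumOfCoordsRep hw) ?_ ?_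
      (mul_ne_zero Fintype.card_ne_zero hq0)
    · rintro _ ⟨F, rfl⟩ hs h0
      -- The stabiliser of `x₀` is transitive on the points that differ from `x₀` in exactly one
      -- coordinate, so `F i p - F i p₀` is one constant `c` for all `i` and all `p ≠ p₀`.
      have hneq : ∀ i j p p', p ≠ p₀ → p' ≠ p₀ →
          ∃ g, φ g x₀ = x₀ ∧ φ g (Function.update x₀ i p) = Function.update x₀ j p' := by
        intro i j p p' hp hp'
        obtain ⟨a, σ, ⟨τ, h⟩, rfl⟩ := htrans i j
        obtain ⟨b, hb, hb'⟩ := hpairs (φ a x₀) (φ a (Function.update x₀ i p)) x₀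
          (Function.update x₀ (σ i) p') (by
            intro l
            rw [IsWreath.apply_update h]
            rcases eq_or_ne l (σ i) with rfl | hl
            · rw [h]
              simp [x₀, hp.symm, hp'.symm]
            · simp [hl])
        exact ⟨b * a, by simpa using hb, by simpa using hb'⟩
      obtain ⟨p₁, hp₁⟩ : ∃ p, p ≠ p₀ := by
        have : Nontrivial P := Fintype.one_lt_card_iff_nontrivial.1 (by omega)
        exact exists_ne p₀
      let i₁ : ι := Classical.arbitrary ι
      let c := (F i₁ : P → ℂ) p₁ - (F i₁ : P → ℂ) p₀
      have hc : ∀ i p, p ≠ p₀ → (F i : P → ℂ) p - (F i : P → ℂ) p₀ = c := by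
        intro i p hp
        obtain ⟨g, hg, hg'⟩ := hneq i i₁ p p₁ hp hp₁
        have := hfix _ hs g hg (Function.update x₀ i p)
        rw [hg', sumOfCoords_update, sumOfCoords_update] at this
        exact (add_left_cancel this).symm
      have hp₀ : ∀ i, (q + 1) * (F i : P → ℂ) p₀ = - (q * c) := by
        intro i
        have h1 := mem_sumZero.1 (F i).2
        rw [← Finset.add_sum_erase _ _ (Finset.mem_univ p₀),
          Finset.sum_congr rfl (g := fun _ => c + (F i : P → ℂ) p₀) fun p hp => by
            rw [← hc i p (Finset.ne_of_mem_erase hp), sub_add_cancel]] at h1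
        rw [Finset.sum_const, Finset.card_erase_of_mem (Finset.mem_univ _), Finset.card_univ, hq,
          Nat.add_sub_cancel, nsmul_eq_mul] at h1
        linear_combination h1
      -- By `hp₀` the value at `x₀` is $-|\iota|qc/(q+1)$, and it is zero by assumption.
      have hc0 : c = 0 := by
        have h1 : (q + 1 : ℂ) * sumOfCoords ι P F x₀ = 0 := by rw [h0, mul_zero]
        rw [sumOfCoords_apply, Finset.mul_sum, Finset.sum_congr rfl fun i _ => hp₀ i] at h1
        simpa [hq0] using h1
      have hF : F = 0 := by
        refine funext fun i => Subtype.ext ?_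
        have : Nonempty P := ⟨p₀⟩
        refine eq_zero_of_const_of_mem_sumZero (F i).2 (c := (F i : P → ℂ) p₀) fun p => ?_
        rcases eq_or_ne p p₀ with rfl | hp
        · rfl
        · exact sub_eq_zero.1 ((hc i p hp).trans hc0)
      rw [hF, map_zero]
    · change Module.finrank ℂ (LinearMap.range (sumOfCoords ι P)) = _
      have : Nonempty P := ⟨p₀⟩
      rw [LinearMap.finrank_range_of_inj sumOfCoords_injective, Module.finrank_pi_fintype]
      simp [finrank_sumZero hq]
  · refine isCharacterDegree_of_spherical ht (lineSumZeroRep hw) ?_ ?_ (pow_ne_zero _ hq0)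
    · intro f hf hs h0
      have hf' : f ∈ lineSumZero ι P := hf
      -- Induction on the number of coordinates differing from `x₀`. On a line in such a coordinate,
      -- the point with coordinate `p₀` has value zero by induction, and the stabiliser of `x₀`
      -- permutes the other `q` points transitively; the line sum is therefore `q * f x`.
      have key : ∀ n : ℕ, ∀ x, (Finset.univ.filter fun i => x i ≠ x₀ i).card = n → f x = 0 := by
        intro n
        induction n with
        | zero =>
          intro x hx
          have : x = x₀ := by
            ext i
            by_contra hi
            exact Finset.notMem_empty i
              (Finset.card_eq_zero.1 hx ▸ Finset.mem_filter.2 ⟨Finset.mem_univ i, hi⟩)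
          rw [this, h0]
        | succ n ih =>
          intro x hx
          obtain ⟨i, hi⟩ : (Finset.univ.filter fun i => x i ≠ x₀ i).Nonempty :=
            Finset.card_pos.1 (by omega)
          have hi' := (Finset.mem_filter.1 hi).2
          have hs' := hf' x i
          rw [← Finset.add_sum_erase _ _ (Finset.mem_univ p₀), ih (Function.update x i p₀),
            Finset.sum_congr rfl (g := fun _ => f x)] at hs'
          · rw [Finset.sum_const, Finset.card_erase_of_mem (Finset.mem_univ _), Finset.card_univ,
              hq, Nat.add_sub_cancel] at hs'
            simpa [hq0] using hs'
          · intro p hp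
            obtain ⟨g, hg, hg'⟩ := hpairs x₀ x x₀ (Function.update x i p) (by
              intro l
              rcases eq_or_ne l i with rfl | hl
              · simp [hi'.symm, x₀, (Finset.ne_of_mem_erase hp).symm]
              · simp [hl])
            rw [← hg', hfix f hs g hg]
          · have : (Finset.univ.filter fun j => Function.update x i p₀ j ≠ x₀ j) =
                (Finset.univ.filter fun j => x j ≠ x₀ j).erase i := by
              ext j
              rcases eq_or_ne j i with rfl | hj
              · simp [x₀]
              · simp [hj]
            rw [this, Finset.card_erase_of_mem hi, hx, Nat.add_sub_cancel]
      exact funext fun x => key _ x rfl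
    · exact finrank_lineSumZero hq

end Wreath

/-! ### Recognising a family of Sylow subgroups. -/

section SylowAction

open scoped Pointwise

/-- An equivariant injective family of `p`-subgroups `T ω`, indexed by a transitive action, such that
every `p`-subgroup lies in some `T ω`, is the family of Sylow `p`-subgroups. -/
theorem exists_equiv_sylow {S Ω : Type*} [Group S] [Finite S] [MulAction S Ω]
    [MulAction.IsPretransitive S Ω] (p : ℕ) (T : Ω → Subgroup S)
    (hconj : ∀ (g : S) ω, T (g • ω) = MulAut.conj g • T ω) (hinj : Function.Injective T)
    (hp : ∀ ω, IsPGroup p (T ω)) (hle : ∀ Q : Subgroup S, IsPGroup p Q → ∃ ω, Q ≤ T ω) :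
    ∃ e : Ω ≃ Sylow p S, ∀ (g : S) ω, e (g • ω) = g • e ω := by
  have hcard : ∀ ω ω', Nat.card (T ω) = Nat.card (T ω') := by
    intro ω ω'
    obtain ⟨g, rfl⟩ := MulAction.exists_smul_eq S ω ω'
    rw [hconj]
    exact Nat.card_congr (Subgroup.equivSMul (MulAut.conj g) (T ω)).toEquiv
  have hT : ∀ ω, ∃ Q : Sylow p S, (Q : Subgroup S) = T ω := by
    intro ω
    obtain ⟨Q, hQ⟩ := (hp ω).exists_le_sylow
    obtain ⟨ω', hω'⟩ := hle Q Q.isPGroup'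
    -- All `T ω` are conjugate, hence of equal order, so the chain `T ω ≤ Q ≤ T ω'` collapses.
    have h : T ω = T ω' := Subgroup.eq_of_le_of_card_ge (hQ.trans hω') (hcard ω' ω).le
    exact ⟨Q, le_antisymm (h ▸ hω') hQ⟩
  choose f hf using hT
  have hfb : Function.Bijective f := by
    refine ⟨fun ω ω' h => hinj (by rw [← hf, ← hf, h]), fun Q => ?_⟩
    obtain ⟨ω, hω⟩ := hle Q Q.isPGroup'
    exact ⟨ω, Sylow.ext ((hf ω).trans (Q.is_maximal' (hp ω) hω))⟩
  refine ⟨Equiv.ofBijective f hfb, fun g ω => Sylow.ext ?_⟩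
  change (f (g • ω) : Subgroup S) = (g • f ω : Sylow p S)
  rw [hf, hconj, Sylow.coe_subgroup_smul, hf]

end SylowAction

/-! ### Sylow subgroups of `PSL(2, F)` in the defining characteristic, and the projective line. -/

section PSL2

open Matrix Matrix.SpecialLinearGroup
open scoped MatrixGroups LinearAlgebra.Projectivization Pointwise

variable {F : Type*} [Field F]

theorem PSL2.isMultiplyPretransitive : MulAction.IsMultiplyPretransitive PSL(2, F)
    (ℙ F (Fin 2 → F)) 2 := by
  have h : MulAction.IsMultiplyPretransitive SL(2, F) (ℙ F (Fin 2 → F)) 2 := inferInstance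
  rw [MulAction.is_two_pretransitive_iff] at h ⊢
  intro a b c d hab hcd
  obtain ⟨g, hg⟩ := h hab hcd
  exact ⟨(g : PSL(2, F)), hg⟩

/-- For a transvection, $A-1$ has square zero, so $A^m=1+m(A-1)$ and $A^p=1$. -/
theorem PSL2.isPGroup_iwasawaT (p : ℕ) [CharP F p] (ω : ℙ F (Fin 2 → F)) :
    IsPGroup p (PSL.iwasawaT ω) := by
  induction ω using Projectivization.ind with | _ v hv => ?_
  refine IsPGroup.map (fun A => ⟨1, Subtype.ext ?_⟩) _
  obtain ⟨A, hA⟩ := A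
  rw [Projectivization.submodule_mk] at hA
  have hfix : ∀ u ∈ Submodule.span F {v}, A • u = u := by
    intro u hu
    obtain ⟨a, rfl⟩ := Submodule.mem_span_singleton.1 hu
    rw [smul_comm, lineStab_fix_of_span v hv A hA]
  have hpow : ∀ (m : ℕ) (w : Fin 2 → F), A ^ m • w = w + (m : F) • (A • w - w) := by
    intro m
    induction m with
    | zero => simp
    | succ m ih =>
      intro w
      rw [pow_succ', mul_smul, ih, smul_add, smul_comm A (m : F), hfix _ (hA w)]
      rw [Nat.cast_succ, add_smul, one_smul]
      generalize (m : F) • (A • w - w) = u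
      abel
  change A ^ p ^ 1 = 1
  rw [pow_one]
  refine Subtype.ext (ext_iff_smul.2 fun w => ?_)
  have := hpow p w
  rw [CharP.cast_eq_zero, zero_smul, add_zero] at this
  exact this.trans (one_smul SL(2, F) w).symm

theorem PSL2.mem_lineStab_of_smul_eq {v : Fin 2 → F} (hv : v ≠ 0) {B : SL(2, F)} (h : B • v = v) :
    B ∈ lineStab (Submodule.span F {v}) := by
  intro w
  have hB : ∀ (u : Fin 2 → F) i, (B • u) i = B.1 i 0 * u 0 + B.1 i 1 * u 1 := by
    intro u i
    simp [Matrix.SpecialLinearGroup.smul_def, Matrix.mulVec, dotProduct, Fin.sum_univ_two]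
  have h0 := congrFun h 0
  have h1 := congrFun h 1
  rw [hB] at h0 h1
  have hdet := B.det_coe
  rw [Matrix.det_fin_two] at hdet
  -- With $Bv=v$ and $\det B=1$: $\det(Bw,v)=\det(Bw,Bv)=\det(w,v)$, so $Bw-w$ is parallel to $v$.
  have hcross : (B • w - w) 0 * v 1 = (B • w - w) 1 * v 0 := by
    rw [Pi.sub_apply, Pi.sub_apply, hB, hB]
    linear_combination (w 0 * v 1 - w 1 * v 0) * hdet
      - (B.1 0 0 * w 0 + B.1 0 1 * w 1) * h1 + (B.1 1 0 * w 0 + B.1 1 1 * w 1) * h0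
  generalize B • w - w = u at hcross
  rw [Submodule.mem_span_singleton]
  by_cases hv0 : v 0 = 0
  · have hv1 : v 1 ≠ 0 := fun hv1 => hv (by ext i; fin_cases i <;> assumption)
    have hu0 : u 0 = 0 := by
      rw [hv0, mul_zero] at hcross
      exact (mul_eq_zero.1 hcross).resolve_right hv1
    refine ⟨u 1 / v 1, ?_⟩
    ext i
    fin_cases i
    · simp [hv0, hu0]
    · simp [hv1]
  · refine ⟨u 0 / v 0, ?_⟩
    ext i
    fin_cases i
    · simp [hv0]
    · simp only [Fin.mk_one, Pi.smul_apply, smul_eq_mul]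
      rw [div_mul_eq_mul_div, hcross, mul_div_assoc, div_self hv0, mul_one]

/-- A lift $A$ has $Av=cv$, and $A^{p^n}$ is a scalar $r$ with $r^2=1$. Then
$(c^2-1)^{p^n}=r^2-1=0$, so $c^2=1$ and the lift $cA$ of the same element fixes $v$. -/
theorem PSL2.mem_iwasawaT_of_pow_eq_one {p : ℕ} [Fact p.Prime] [CharP F p] {ω : ℙ F (Fin 2 → F)}
    {g : PSL(2, F)} (hg : g • ω = ω) {n : ℕ} (hn : g ^ p ^ n = 1) : g ∈ PSL.iwasawaT ω := by
  induction ω using Projectivization.ind with | _ v hv => ?_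
  obtain ⟨A, rfl⟩ := QuotientGroup.mk_surjective g
  rw [Matrix.ProjectiveSpecialLinearGroup.smul_proj_mk, Projectivization.smul_mk,
    Projectivization.mk_eq_mk_iff'] at hg
  obtain ⟨c, hc⟩ := hg
  have hpow : ∀ m : ℕ, A ^ m • v = c ^ m • v := by
    intro m
    induction m with
    | zero => simp
    | succ m ih => rw [pow_succ', mul_smul, ih, smul_comm, ← hc, smul_smul, pow_succ]
  rw [← QuotientGroup.mk_pow, QuotientGroup.eq_one_iff, mem_center_iff] at hn
  obtain ⟨r, hr, hr'⟩ := hn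
  have hcr : c ^ p ^ n = r := by
    have h1 := hpow (p ^ n)
    have h2 : A ^ p ^ n • v = r • v := by
      rw [Matrix.SpecialLinearGroup.smul_def, ← hr']
      simp
    exact smul_left_injective F hv (h1.symm.trans h2)
  have hc2 : c ^ 2 = 1 := by
    have h1 : (c ^ 2 - 1) ^ p ^ n = 0 := by
      rw [sub_pow_char_pow, one_pow, ← pow_mul, mul_comm, pow_mul, hcr, sub_eq_zero]
      simpa using hr
    exact sub_eq_zero.1 (pow_eq_zero_iff (pow_ne_zero n (Fact.out : p.Prime).ne_zero) |>.1 h1)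
  let Z : SL(2, F) := ⟨Matrix.scalar (Fin 2) c, by simp [← hc2]⟩
  have hZ : Z ∈ Subgroup.center SL(2, F) := mem_center_iff.2 ⟨c, by simpa using hc2, rfl⟩
  refine ⟨Z * A, ?_, ?_⟩
  · rw [Projectivization.submodule_mk]
    refine mem_lineStab_of_smul_eq hv ?_
    rw [mul_smul, ← hc, Matrix.SpecialLinearGroup.smul_def]
    simp [Z, smul_smul, ← pow_two, hc2]
  · have : (QuotientGroup.mk Z : PSL(2, F)) = 1 := (QuotientGroup.eq_one_iff Z).2 hZ
    rw [QuotientGroup.mk'_apply, QuotientGroup.mk_mul, this, one_mul]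

theorem PSL2.iwasawaT_smul {g : PSL(2, F)} {ω : ℙ F (Fin 2 → F)} :
    PSL.iwasawaT (g • ω) = MulAut.conj g • PSL.iwasawaT ω :=
  PSL2.Iwasawa.is_conj g ω

theorem PSL2.smul_eq_of_mem_iwasawaT {g : PSL(2, F)} {ω : ℙ F (Fin 2 → F)}
    (hg : g ∈ PSL.iwasawaT ω) : g • ω = ω := by
  induction ω using Projectivization.ind with | _ v hv => ?_
  obtain ⟨A, hA, rfl⟩ := hg
  rw [SetLike.mem_coe, Projectivization.submodule_mk] at hA
  rw [QuotientGroup.mk'_apply, Matrix.ProjectiveSpecialLinearGroup.smul_proj_mk,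
    Projectivization.smul_mk, Projectivization.mk_eq_mk_iff']
  exact ⟨1, by rw [one_smul, lineStab_fix_of_span v hv A hA]⟩

/-- If two of these subgroups agreed, double transitivity would make all of them equal. As they
generate the group, each would be the whole group, yet each fixes a point. -/
theorem PSL2.iwasawaT_injective :
    Function.Injective (PSL.iwasawaT : ℙ F (Fin 2 → F) → Subgroup PSL(2, F)) := by
  intro a b hab
  by_contra hne
  have htop : PSL.iwasawaT a = ⊤ := by
    rw [eq_top_iff, ← PSL2.Iwasawa.is_generator]
    refine iSup_le fun c => le_of_eq ?_
    rcases eq_or_ne c a with rfl | hca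
    · rfl
    · obtain ⟨g, rfl, hg⟩ :=
        MulAction.is_two_pretransitive_iff.1 PSL2.isMultiplyPretransitive hne hca
      nth_rw 2 [← hg]
      change PSL.iwasawaT (g • a) = _
      rw [PSL2.iwasawaT_smul, PSL2.iwasawaT_smul, hab]
  obtain ⟨g, hg, -⟩ :=
    MulAction.is_two_pretransitive_iff.1 PSL2.isMultiplyPretransitive hne (Ne.symm hne)
  have : g ∈ PSL.iwasawaT a := htop ▸ Subgroup.mem_top g
  exact hne ((PSL2.smul_eq_of_mem_iwasawaT this).symm.trans hg)

theorem PSL2.exists_mul_ne : ∃ g h : PSL(2, F), g * h ≠ h * g := by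
  by_contra! hcomm
  obtain ⟨a, b, hab⟩ : ∃ a b : ℙ F (Fin 2 → F), a ≠ b := by
    refine ⟨.mk F ![1, 0] (by simp), .mk F ![0, 1] (by simp), fun h => ?_⟩
    obtain ⟨c, hc⟩ := (Projectivization.mk_eq_mk_iff' F _ _ _ _).1 h
    simpa using congrFun hc 0
  obtain ⟨g, hg, -⟩ :=
    MulAction.is_two_pretransitive_iff.1 PSL2.isMultiplyPretransitive hab hab.symm
  have h : MulAut.conj g = 1 := by
    ext x
    rw [MulAut.conj_apply, hcomm, inv_mul_cancel_left, MulAut.one_apply]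
  refine hab (PSL2.iwasawaT_injective ?_)
  rw [← hg, PSL2.iwasawaT_smul, h, one_smul]

theorem PSL2.exists_equiv_sylow [Finite F] (p : ℕ) [Fact p.Prime]
    [CharP F p] : ∃ e : ℙ F (Fin 2 → F) ≃ Sylow p PSL(2, F),
      ∀ (g : PSL(2, F)) ω, e (g • ω) = g • e ω := by
  refine CharacterDegreeRatio.exists_equiv_sylow p PSL.iwasawaT PSL2.Iwasawa.is_conj
    PSL2.iwasawaT_injective (PSL2.isPGroup_iwasawaT p) fun Q hQ => ?_
  have hcard : Nat.card (ℙ F (Fin 2 → F)) = Nat.card F + 1 :=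
    Projectivization.card_of_finrank_two F _ (by simp)
  have hdvd : p ∣ Nat.card F := (CharP.cast_eq_zero_iff F p _).1 (by
    have := Fintype.ofFinite F
    rw [Nat.card_eq_fintype_card, Nat.cast_card_eq_zero])
  -- A `p`-group acting on $q+1\equiv 1 \pmod p$ points fixes one.
  obtain ⟨ω, hω⟩ := hQ.nonempty_fixed_point_of_prime_not_dvd_card (ℙ F (Fin 2 → F)) (by
    rw [hcard]
    exact fun h => (Fact.out : p.Prime).one_lt.ne' (Nat.dvd_one.1 ((Nat.dvd_add_right hdvd).1 h)))
  refine ⟨ω, fun g hg => ?_⟩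
  obtain ⟨n, hn⟩ := hQ ⟨g, hg⟩
  exact PSL2.mem_iwasawaT_of_pow_eq_one (hω ⟨g, hg⟩) (n := n) (congrArg Subtype.val hn)

theorem PSL2.card_sylow [Finite F] (p : ℕ) [Fact p.Prime] [CharP F p] :
    Nat.card (Sylow p PSL(2, F)) = Nat.card F + 1 := by
  obtain ⟨e, -⟩ := PSL2.exists_equiv_sylow (F := F) p
  rw [← Nat.card_congr e, Projectivization.card_of_finrank_two F _ (by simp)]

theorem PSL2.isMultiplyPretransitive_sylow [Finite F] (p : ℕ)
    [Fact p.Prime] [CharP F p] :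
    MulAction.IsMultiplyPretransitive PSL(2, F) (Sylow p PSL(2, F)) 2 := by
  obtain ⟨e, he⟩ := PSL2.exists_equiv_sylow (F := F) p
  rw [MulAction.is_two_pretransitive_iff]
  intro a b c d hab hcd
  obtain ⟨g, hg, hg'⟩ := MulAction.is_two_pretransitive_iff.1 PSL2.isMultiplyPretransitive
    (e.symm.injective.ne hab) (e.symm.injective.ne hcd)
  refine ⟨g, ?_, ?_⟩
  · rw [← e.apply_symm_apply a, ← he, hg, e.apply_symm_apply]
  · rw [← e.apply_symm_apply b, ← he, hg', e.apply_symm_apply]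

end PSL2

/-! ### Automorphisms and Sylow subgroups of a power of a simple group. -/

section Powers

open scoped Pointwise

variable {ι S : Type*} [DecidableEq ι] [Group S]

theorem exists_mul_ne_mul_of_ne_one [IsSimpleGroup S] (hS : ∃ g h : S, g * h ≠ h * g) {a : S}
    (ha : a ≠ 1) : ∃ b, a * b ≠ b * a := by
  by_contra! h
  have hc : a ∈ Subgroup.center S := Subgroup.mem_center_iff.2 fun b => (h b).symm
  rcases Subgroup.Normal.eq_bot_or_eq_top (H := Subgroup.center S) inferInstance with hb | ht
  · rw [hb, Subgroup.mem_bot] at hc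
    exact ha hc
  · obtain ⟨g, g', hg⟩ := hS
    have : g' ∈ Subgroup.center S := ht ▸ Subgroup.mem_top g'
    exact hg (Subgroup.mem_center_iff.1 this g)

/-- A normal subgroup of a power of a nonabelian simple group contains every factor to which it
projects nontrivially. -/
theorem mulSingle_mem_of_normal [IsSimpleGroup S] (hS : ∃ g h : S, g * h ≠ h * g)
    (M : Subgroup (ι → S)) [hM : M.Normal] {m : ι → S} (hm : m ∈ M) {j : ι} (hj : m j ≠ 1)
    (t : S) : Pi.mulSingle j t ∈ M := by
  obtain ⟨b, hb⟩ := exists_mul_ne_mul_of_ne_one hS hj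
  -- The commutator of `m` with an element of factor `j` lies in `M` and in that factor, and `b`
  -- makes it nontrivial; simplicity then gives the whole factor.
  have hcomm : Pi.mulSingle j (m j * b * (m j)⁻¹ * b⁻¹) ∈ M := by
    have h1 : m * (Pi.mulSingle j b * m⁻¹ * (Pi.mulSingle j b)⁻¹) ∈ M :=
      M.mul_mem hm (hM.conj_mem _ (M.inv_mem hm) _)
    convert h1 using 1
    ext i
    rcases eq_or_ne i j with rfl | hi
    · simp [mul_assoc]
    · simp [hi]
  let K : Subgroup S := M.comap (MonoidHom.mulSingle (fun _ => S) j)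
  have hK : ∀ s, s ∈ K ↔ Pi.mulSingle j s ∈ M := fun s => Iff.rfl
  rcases Subgroup.Normal.eq_bot_or_eq_top (H := K) inferInstance with h | h
  · have := (hK _).2 hcomm
    rw [h, Subgroup.mem_bot, mul_inv_eq_one, mul_inv_eq_iff_eq_mul] at this
    exact absurd this hb
  · exact (hK t).1 (h ▸ Subgroup.mem_top t)

/-- The automorphisms of a power of a nonabelian simple group permute the factors. -/
theorem exists_perm_of_mulAut [Finite ι] [Finite S] [IsSimpleGroup S]
    (hS : ∃ g h : S, g * h ≠ h * g) (α : MulAut (ι → S)) :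
    ∃ σ : Perm ι, ∀ i, ∃ β : Perm S, ∀ s, α (Pi.mulSingle i s) = Pi.mulSingle (σ i) (β s) := by
  -- The image of factor `i` is normal, so it contains a whole factor `j`; finiteness of `S` later
  -- turns this inclusion into equality.
  have h1 : ∀ i, ∃ j, ∀ t, ∃ s, α (Pi.mulSingle i s) = Pi.mulSingle j t := by
    intro i
    obtain ⟨s, hs⟩ := exists_ne (1 : S)
    have hne : α (Pi.mulSingle i s) ≠ 1 := by
      simpa [EmbeddingLike.map_eq_one_iff] using hs
    obtain ⟨j, hj⟩ := Function.ne_iff.1 hne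
    let M : Subgroup (ι → S) := (MonoidHom.mulSingle (fun _ => S) i).range.map α.toMonoidHom
    have hR : (MonoidHom.mulSingle (fun _ : ι => S) i).range.Normal := by
      constructor
      rintro _ ⟨t, rfl⟩ g
      refine ⟨g i * t * (g i)⁻¹, ?_⟩
      ext l
      rcases eq_or_ne l i with rfl | hl
      · simp
      · simp [hl]
    have hM : M.Normal := hR.map _ α.surjective
    refine ⟨j, fun t => ?_⟩
    obtain ⟨_, ⟨u, rfl⟩, hu⟩ := mulSingle_mem_of_normal hS M (m := α (Pi.mulSingle i s))
      ⟨_, ⟨s, rfl⟩, rfl⟩ hj t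
    exact ⟨u, hu⟩
  choose σ h using h1
  have hσ : Function.Injective σ := by
    intro i i' hii
    obtain ⟨t, ht⟩ := exists_ne (1 : S)
    obtain ⟨s, hs⟩ := h i t
    obtain ⟨s', hs'⟩ := h i' t
    rw [← hii, ← hs] at hs'
    have heq := α.injective hs'
    by_contra hne
    have := congrFun heq i
    rw [Pi.mulSingle_eq_same, Pi.mulSingle_eq_of_ne hne] at this
    rw [← this, Pi.mulSingle_one, map_one] at hs
    exact ht ((Pi.mulSingle_eq_one_iff).1 hs.symm)
  refine ⟨Equiv.ofBijective σ (Finite.injective_iff_bijective.1 hσ), fun i => ?_⟩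
  choose f hf using h i
  have hfi : Function.Injective f := fun t t' htt =>
    Pi.mulSingle_injective (σ i) ((hf t).symm.trans ((congrArg _ (by rw [htt])).trans (hf t')))
  refine ⟨(Equiv.ofBijective f (Finite.injective_iff_bijective.1 hfi)).symm, fun s => ?_⟩
  obtain ⟨t, rfl⟩ := (Finite.injective_iff_bijective.1 hfi).2 s
  rw [Equiv.ofBijective_symm_apply_apply]
  exact hf t

variable (p : ℕ)

theorem isPGroup_pi [Finite ι] {H : ι → Subgroup S} (h : ∀ i, IsPGroup p (H i)) :
    IsPGroup p (Subgroup.pi Set.univ H) := by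
  have := Fintype.ofFinite ι
  rintro ⟨x, hx⟩
  choose n hn using fun i => h i ⟨x i, hx i (Set.mem_univ i)⟩
  refine ⟨∑ i, n i, Subtype.ext (funext fun i => ?_)⟩
  have h1 : x i ^ p ^ n i = 1 := congrArg Subtype.val (hn i)
  change x i ^ p ^ (∑ i, n i) = 1
  rw [← Finset.add_sum_erase _ _ (Finset.mem_univ i), pow_add, pow_mul, h1, one_pow]

/-- The product of Sylow subgroups of the factors. -/
def sylowPi [Finite ι] (x : ι → Sylow p S) : Sylow p (ι → S) where
  toSubgroup := Subgroup.pi Set.univ fun i => (x i : Subgroup S)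
  isPGroup' := isPGroup_pi p fun i => (x i).isPGroup'
  is_maximal' := by
    intro Q hQ hle
    refine le_antisymm (fun y hy i _ => ?_) hle
    -- Each projection of `Q` is a `p`-group containing the Sylow subgroup `x i`, hence equal to it.
    have h1 : (x i : Subgroup S) ≤ Q.map (Pi.evalMonoidHom (fun _ => S) i) := by
      intro s hs
      refine ⟨Pi.mulSingle i s, hle fun j _ => ?_, by simp⟩
      rcases eq_or_ne j i with rfl | hj
      · simpa using hs
      · rw [Pi.mulSingle_eq_of_ne hj]
        exact Subgroup.one_mem _
    have h2 := (x i).is_maximal' (hQ.map _) h1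
    change y i ∈ (x i : Subgroup S)
    rw [← h2]
    exact ⟨y, hy, rfl⟩

variable {p}

theorem mem_sylowPi [Finite ι] {x : ι → Sylow p S} {y : ι → S} :
    y ∈ sylowPi p x ↔ ∀ i, y i ∈ x i :=
  ⟨fun h i => h i (Set.mem_univ i), fun h i _ => h i⟩

theorem mulSingle_mem_sylowPi [Finite ι] {x : ι → Sylow p S} {i : ι} {s : S} :
    Pi.mulSingle i s ∈ sylowPi p x ↔ s ∈ x i := by
  rw [mem_sylowPi]
  refine ⟨fun h => by simpa using h i, fun h j => ?_⟩
  rcases eq_or_ne j i with rfl | hj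
  · simpa using h
  · rw [Pi.mulSingle_eq_of_ne hj]
    exact one_mem _

theorem sylowPi_bijective [Finite ι] : Function.Bijective (sylowPi (ι := ι) (S := S) p) := by
  constructor
  · intro x x' h
    refine funext fun i => SetLike.ext fun s => ?_
    rw [← mulSingle_mem_sylowPi, h, mulSingle_mem_sylowPi]
  · intro Q
    have h : ∀ i, ∃ R : Sylow p S, Q.map (Pi.evalMonoidHom (fun _ => S) i) ≤ R :=
      fun i => (Q.isPGroup'.map _).exists_le_sylow
    choose x hx using h
    refine ⟨x, Sylow.ext (Q.is_maximal' (sylowPi p x).isPGroup' fun y hy => ?_)⟩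
    exact mem_sylowPi.2 fun i => hx i ⟨y, hy, rfl⟩

/-- The action of the automorphisms of `ι → S` on the families of Sylow subgroups of `S`. -/
noncomputable def sylowPiAction (ι S : Type*) [DecidableEq ι] [Finite ι] [Group S] (p : ℕ) :
    MulAut (ι → S) →* Perm (ι → Sylow p S) :=
  (Equiv.ofBijective _ sylowPi_bijective).symm.permCongrHom.toMonoidHom.comp
    (MulAction.toPermHom (MulAut (ι → S)) (Sylow p (ι → S)))

theorem sylowPi_action [Finite ι] (α : MulAut (ι → S)) (x : ι → Sylow p S) :
    sylowPi p (sylowPiAction ι S p α x) = α • sylowPi p x :=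
  (Equiv.ofBijective _ sylowPi_bijective).apply_symm_apply (α • sylowPi p x)

theorem sylowPiAction_conj [Finite ι] (n : ι → S) (x : ι → Sylow p S) :
    sylowPiAction ι S p (MulAut.conj n) x = fun i => n i • x i := by
  refine sylowPi_bijective.1 ?_
  rw [sylowPi_action]
  refine SetLike.ext fun y => ?_
  rw [mem_sylowPi]
  change y ∈ MulAut.conj n • (sylowPi p x : Subgroup (ι → S)) ↔
    ∀ i, y i ∈ MulAut.conj (n i) • (x i : Subgroup S)
  simp only [Subgroup.mem_pointwise_smul_iff_inv_smul_mem, MulAut.smul_def, MulAut.inv_apply,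
    MulAut.conj_symm_apply]
  exact mem_sylowPi

/-- Constant families already determine the coordinate maps; these are injective because `π` is, and
bijective because `P` is finite. -/
theorem isWreath_of_forall_eq [Finite ι] {P : Type*} [Finite P] {π : Perm (ι → P)} {σ : Perm ι}
    (h : ∀ x x' i, x i = x' i → π x (σ i) = π x' (σ i)) : IsWreath π σ := by
  let f : ι → P → P := fun i a => π (fun _ => a) (σ i)
  have hf : ∀ i, Function.Injective (f i) := by
    intro i a b hab
    have heq : π (fun _ => a) = π (Function.update (fun _ => a) i b) := by
      ext j
      obtain ⟨j, rfl⟩ := σ.surjective j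
      rcases eq_or_ne j i with rfl | hj
      · exact hab.trans (h _ _ _ (by simp))
      · exact h _ _ _ (by simp [hj])
    simpa using congrFun (π.injective heq) i
  exact ⟨fun i => Equiv.ofBijective (f i) (Finite.injective_iff_bijective.1 (hf i)),
    fun x i => h _ _ _ rfl⟩

theorem isWreath_sylowPiAction [Finite ι] [Finite S] {α : MulAut (ι → S)} {σ : Perm ι}
    (h : ∀ i, ∃ β : Perm S, ∀ s, α (Pi.mulSingle i s) = Pi.mulSingle (σ i) (β s)) :
    IsWreath (sylowPiAction ι S p α) σ := by
  refine isWreath_of_forall_eq fun x x' i hx => ?_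
  obtain ⟨β, hβ⟩ := h i
  have key : ∀ x : ι → Sylow p S, ∀ s, s ∈ sylowPiAction ι S p α x (σ i) ↔ β.symm s ∈ x i := by
    intro x s
    rw [← mulSingle_mem_sylowPi, sylowPi_action]
    change Pi.mulSingle (σ i) s ∈ α • (sylowPi p x : Subgroup (ι → S)) ↔ _
    rw [Subgroup.mem_pointwise_smul_iff_inv_smul_mem, ← mulSingle_mem_sylowPi]
    have : α⁻¹ • (Pi.mulSingle (σ i) s : ι → S) = Pi.mulSingle i (β.symm s) := by
      rw [MulAut.smul_def, MulAut.inv_apply, MulEquiv.symm_apply_eq, hβ, Equiv.apply_symm_apply]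
    rw [this]
    rfl
  exact SetLike.ext fun s => by rw [key, key, hx]

end Powers

/-! ### The conjugation action on a minimal normal subgroup. -/

section MinimalNormal

variable {G ι S : Type*} [Group G] [Group S] {N : Subgroup G}

/-- The action by conjugation on a normal subgroup that is isomorphic to a power. -/
noncomputable def conjPower [N.Normal] (e : N ≃* (ι → S)) : G →* MulAut (ι → S) :=
  (MulAut.congr e).toMonoidHom.comp MulAut.conjNormal

theorem conjPower_apply [N.Normal] (e : N ≃* (ι → S)) (g : G) (n : N) :
    conjPower e g (e n) = e (MulAut.conjNormal g n) := by
  simp [conjPower, MulAut.congr]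

theorem conjPower_coe [N.Normal] (e : N ≃* (ι → S)) (n : N) :
    conjPower e (n : G) = MulAut.conj (e n) := by
  ext1 y
  obtain ⟨m, rfl⟩ := e.surjective y
  rw [conjPower_apply, MulAut.conj_apply, ← map_inv, ← map_mul, ← map_mul]
  exact congrArg e (Subtype.ext (by simp))

/-- `G` permutes the simple factors of a minimal normal subgroup transitively. -/
theorem exists_conjPower_perm_eq [DecidableEq ι] [Finite ι] [Finite S] [IsSimpleGroup S] [N.Normal]
    (hS : ∃ g h : S, g * h ≠ h * g) (hN : IsMinimalNormal N) (e : N ≃* (ι → S)) (i j : ι) :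
    ∃ g, ∃ σ : Perm ι, (∀ i, ∃ β : Perm S, ∀ s,
      conjPower e g (Pi.mulSingle i s) = Pi.mulSingle (σ i) (β s)) ∧ σ i = j := by
  by_contra! hne
  let M : Subgroup G :=
    Subgroup.normalClosure (Set.range fun s => (e.symm (Pi.mulSingle i s) : G))
  have hMN : M ≤ N := by
    refine Subgroup.normalClosure_le_normal ?_
    rintro _ ⟨s, rfl⟩
    exact (e.symm _).2
  obtain ⟨s, hs⟩ := exists_ne (1 : S)
  have hMbot : M ≠ ⊥ := by
    intro h
    have h1 : (e.symm (Pi.mulSingle i s) : G) ∈ M := Subgroup.subset_normalClosure ⟨s, rfl⟩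
    rw [h, Subgroup.mem_bot] at h1
    have h2 : e.symm (Pi.mulSingle i s) = 1 := Subtype.ext h1
    rw [MulEquiv.map_eq_one_iff, Pi.mulSingle_eq_one_iff] at h2
    exact hs h2
  have hM : M = N := (hN.2.2 M Subgroup.normalClosure_normal hMN).resolve_left hMbot
  -- If no element carries factor `i` to factor `j`, all conjugates of factor `i` lie in the kernel
  -- `K` of the projection to `j`. Their normal closure is `N` by minimality, but `N` is not
  -- contained in `K`.
  let K : Subgroup G :=
    ((Pi.evalMonoidHom (fun _ => S) j).comp e.toMonoidHom).ker.map N.subtype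
  have hMK : M ≤ K := by
    refine (Subgroup.closure_le K).2 fun y hy => ?_
    obtain ⟨_, ⟨t, rfl⟩, hy⟩ := Group.mem_conjugatesOfSet_iff.1 hy
    obtain ⟨g, rfl⟩ := isConj_iff.1 hy
    refine ⟨MulAut.conjNormal g (e.symm (Pi.mulSingle i t)), ?_, by simp⟩
    obtain ⟨σ, hσ⟩ := exists_perm_of_mulAut hS (conjPower e g)
    obtain ⟨β, hβ⟩ := hσ i
    have hj : j ≠ σ i := (hne g σ hσ).symm
    change e (MulAut.conjNormal g (e.symm (Pi.mulSingle i t))) j = 1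
    rw [← conjPower_apply, e.apply_symm_apply, hβ, Pi.mulSingle_eq_of_ne hj]
  have h1 : (e.symm (Pi.mulSingle j s) : G) ∈ K := hMK (hM.ge (e.symm _).2)
  obtain ⟨n, hn, hn'⟩ := h1
  have h2 : n = e.symm (Pi.mulSingle j s) := Subtype.ext hn'
  have h3 : e n j = 1 := hn
  rw [h2, e.apply_symm_apply, Pi.mulSingle_eq_same] at h3
  exact hs h3

/-- The degrees of the irreducible constituents on the families of Sylow subgroups of the factors of
a minimal normal subgroup. -/
theorem isCharacterDegree_of_isMinimalNormal [Finite G] [DecidableEq ι] [Fintype ι] [Nonempty ι] [Finite S]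
    [IsSimpleGroup S] (hS : ∃ g h : S, g * h ≠ h * g) (hN : IsMinimalNormal N) (e : N ≃* (ι → S))
    {p q : ℕ} [MulAction.IsMultiplyPretransitive S (Sylow p S) 2]
    [MulAction.IsPretransitive S (Sylow p S)]
    (hq : Nat.card (Sylow p S) = q + 1) (hq0 : q ≠ 0) :
    IsCharacterDegree G (Fintype.card ι * q) ∧ IsCharacterDegree G (q ^ Fintype.card ι) := by
  have := hN.1
  have := Fintype.ofFinite (Sylow p S)
  rw [Nat.card_eq_fintype_card] at hq
  refine isCharacterDegree_of_wreath (φ := (sylowPiAction ι S p).comp (conjPower e))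
    (fun g => ?_) (fun i j => ?_) (fun x y x' y' h => ?_) hq hq0
  · obtain ⟨σ, hσ⟩ := exists_perm_of_mulAut hS (conjPower e g)
    exact ⟨σ, isWreath_sylowPiAction hσ⟩
  · obtain ⟨g, σ, hσ, hij⟩ := exists_conjPower_perm_eq hS hN e i j
    exact ⟨g, σ, isWreath_sylowPiAction hσ, hij⟩
  -- Elements of `N` act independently in each coordinate, so transitivity and double transitivity
  -- of `S` suffice coordinate by coordinate.
  · have hs : ∀ i, ∃ s : S, s • x i = x' i ∧ s • y i = y' i := by
      intro i
      by_cases hi : x i = y i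
      · rw [← hi, ← (h i).1 hi]
        exact (MulAction.exists_smul_eq S (x i) (x' i)).imp fun s hs => ⟨hs, hs⟩
      · exact MulAction.is_two_pretransitive_iff.1 inferInstance hi (mt (h i).2 hi)
    choose s hs hs' using hs
    refine ⟨(e.symm s : N), ?_, ?_⟩
    · rw [MonoidHom.comp_apply, conjPower_coe, e.apply_symm_apply, sylowPiAction_conj]
      exact funext hs
    · rw [MonoidHom.comp_apply, conjPower_coe, e.apply_symm_apply, sylowPiAction_conj]
      exact funext hs'

end MinimalNormal

/-! ### The numerical estimate and the degree ratio. -/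

section Bound

/-- Induction with step $(k+1)e\le 5k$, which fails at $k=1$; hence the start at $k=2$, where the
claim is $2e^{0.7}<5$. -/
theorem natCast_mul_exp_lt {k : ℕ} (hk : 2 ≤ k) :
    (k : ℝ) * Real.exp ((k : ℝ) - 1.3) < 5 ^ (k - 1) := by
  induction k, hk using Nat.le_induction with
  | base =>
    have h : Real.exp 0.7 < 2.5 := by
      refine lt_of_pow_lt_pow_left₀ 10 (by norm_num) ?_
      rw [← Real.exp_nat_mul]
      have h7 : Real.exp (((10 : ℕ) : ℝ) * 0.7) = Real.exp 1 ^ 7 := by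
        rw [← Real.exp_nat_mul]; norm_num
      rw [h7]
      calc Real.exp 1 ^ 7 < 2.7182818286 ^ 7 :=
            pow_lt_pow_left₀ Real.exp_one_lt_d9 (Real.exp_pos 1).le (by norm_num)
        _ < 2.5 ^ 10 := by norm_num
    have h2 : ((2 : ℕ) : ℝ) - 1.3 = 0.7 := by norm_num
    rw [h2]
    norm_num at h ⊢
    linarith
  | succ k hk ih =>
    have hk' : (2 : ℝ) ≤ k := by exact_mod_cast hk
    have h1 : ((k + 1 : ℕ) : ℝ) - 1.3 = (k - 1.3) + 1 := by push_cast; ring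
    obtain ⟨m, rfl⟩ : ∃ m, k = m + 1 := ⟨k - 1, by omega⟩
    rw [h1, Real.exp_add, Nat.add_sub_cancel, pow_succ]
    rw [Nat.add_sub_cancel] at ih
    have he : Real.exp 1 < 2.72 := Real.exp_one_lt_d9.trans (by norm_num)
    have hx := Real.exp_pos (((m + 1 : ℕ) : ℝ) - 1.3)
    have hstep : ((m + 1 + 1 : ℕ) : ℝ) * Real.exp 1 ≤ ((m + 1 : ℕ) : ℝ) * 5 := by
      push_cast at hk' ⊢
      nlinarith
    calc ((m + 1 + 1 : ℕ) : ℝ) * (Real.exp (((m + 1 : ℕ) : ℝ) - 1.3) * Real.exp 1)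
        = Real.exp (((m + 1 : ℕ) : ℝ) - 1.3) * (((m + 1 + 1 : ℕ) : ℝ) * Real.exp 1) := by ring
      _ ≤ Real.exp (((m + 1 : ℕ) : ℝ) - 1.3) * (((m + 1 : ℕ) : ℝ) * 5) :=
          mul_le_mul_of_nonneg_left hstep hx.le
      _ < 5 ^ m * 5 := by linarith

theorem exp_lt_pow_div {q k : ℕ} (hq : 5 ≤ q) (hk : k ≠ 0) :
    Real.exp ((k : ℝ) - 1.3) < (q : ℝ) ^ k / (k * q : ℝ) := by
  have hq' : (5 : ℝ) ≤ q := by exact_mod_cast hq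
  obtain ⟨m, rfl⟩ := Nat.exists_eq_succ_of_ne_zero hk
  have hq0 : (q : ℝ) ≠ 0 := ne_of_gt (by linarith)
  have hpos : (0 : ℝ) < (m.succ : ℕ) := by exact_mod_cast m.succ_pos
  rw [pow_succ, mul_div_mul_right _ _ hq0, lt_div_iff₀ hpos]
  rcases Nat.eq_zero_or_pos m with rfl | hm
  · have : Real.exp (((Nat.succ 0 : ℕ) : ℝ) - 1.3) < 1 := by
      rw [Real.exp_lt_one_iff]; norm_num
    simpa using this
  · calc Real.exp ((m.succ : ℝ) - 1.3) * m.succ = m.succ * Real.exp ((m.succ : ℝ) - 1.3) :=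
          mul_comm _ _
      _ < 5 ^ m := natCast_mul_exp_lt (k := m.succ) (by omega)
      _ ≤ (q : ℝ) ^ m := pow_le_pow_left₀ (by norm_num) hq' m

theorem le_maxDegree {G : Type*} [Group G] [Finite G] {d : ℕ} (h : IsCharacterDegree G d) :
    d ≤ maxDegree G :=
  le_csSup ⟨Nat.card G, fun _ hd => hd.le_card⟩ h

theorem minNonlinearDegree_le {G : Type*} [Group G] {d : ℕ} (hG : ¬∀ x y : G, x * y = y * x)
    (h : IsCharacterDegree G d) (hd : 1 < d) : minNonlinearDegree G ≤ d := by
  rw [minNonlinearDegree, if_neg hG]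
  exact Nat.sInf_le ⟨h, hd⟩

theorem minNonlinearDegree_pos {G : Type*} [Group G] {d : ℕ} (hG : ¬∀ x y : G, x * y = y * x)
    (h : IsCharacterDegree G d) (hd : 1 < d) : 0 < minNonlinearDegree G := by
  rw [minNonlinearDegree, if_neg hG]
  exact zero_lt_one.trans (Nat.sInf_mem (s := {d : ℕ | IsCharacterDegree G d ∧ 1 < d}) ⟨d, h, hd⟩).2

/-- A quotient of two character degrees, the second of them nonlinear, bounds the ratio. -/
theorem div_le_rat {G : Type*} [Group G] [Finite G] (hG : ¬∀ x y : G, x * y = y * x) {b c : ℕ}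
    (hb : IsCharacterDegree G b) (hc : IsCharacterDegree G c) (hc1 : 1 < c) :
    (b : ℝ) / c ≤ rat G := by
  rw [rat, if_neg hG]
  have h1 : (b : ℝ) ≤ maxDegree G := by exact_mod_cast le_maxDegree hb
  have h2 : (minNonlinearDegree G : ℝ) ≤ c := by exact_mod_cast minNonlinearDegree_le hG hc hc1
  have h3 : (0 : ℝ) < minNonlinearDegree G := by exact_mod_cast minNonlinearDegree_pos hG hc hc1
  exact div_le_div₀ (Nat.cast_nonneg _) h1 h3 h2

end Bound

end CharacterDegreeRatio

theorem mainTheorem4 {G : Type*} [Group G] [Finite G] {F : Type*} [Field F] [Finite F]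
    (q : ℕ) (hqF : Nat.card F = q) (hq : 5 ≤ q) (k : ℕ) (N : Subgroup G)
    (hN : CharacterDegreeRatio.IsMinimalNormal N)
    (hNS : Nonempty (N ≃* (Fin k → Matrix.ProjectiveSpecialLinearGroup (Fin 2) F))) :
    (k : ℝ) < Real.log (CharacterDegreeRatio.rat G) + 1.3 ∧
      CharacterDegreeRatio.IsCharacterDegree G (k * q) ∧
      CharacterDegreeRatio.IsCharacterDegree G (q ^ k) := by
  obtain ⟨e⟩ := hNS
  have hk : k ≠ 0 := by
    rintro rfl
    have := e.toEquiv.subsingleton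
    exact hN.2.1 (Subgroup.eq_bot_of_subsingleton N)
  have hk1 : 1 ≤ k := Nat.one_le_iff_ne_zero.2 hk
  have : Nonempty (Fin k) := ⟨⟨0, hk1⟩⟩
  obtain ⟨p, hp⟩ := CharP.exists F
  have : Fact p.Prime := ⟨CharP.char_is_prime F p⟩
  -- The bound `5 ≤ q` provides simplicity here, and is used again in the numerical estimate.
  have := Matrix.ProjectiveSpecialLinearGroup.rank_two_simple (F := F) (by omega)
  have := CharacterDegreeRatio.PSL2.isMultiplyPretransitive_sylow (F := F) p
  have hdeg := CharacterDegreeRatio.isCharacterDegree_of_isMinimalNormal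
    CharacterDegreeRatio.PSL2.exists_mul_ne hN e (p := p) (q := q) (hqF ▸ CharacterDegreeRatio.PSL2.card_sylow (F := F) p) (by omega)
  rw [Fintype.card_fin] at hdeg
  refine ⟨?_, hdeg⟩
  have hG : ¬∀ x y : G, x * y = y * x := by
    intro hcomm
    obtain ⟨g, h, hgh⟩ := CharacterDegreeRatio.PSL2.exists_mul_ne (F := F)
    apply hgh
    have h1 := congrArg e (Subtype.ext (hcomm (e.symm fun _ => g) (e.symm fun _ => h)) :
      e.symm (fun _ => g) * e.symm (fun _ => h) = e.symm (fun _ => h) * e.symm fun _ => g)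
    simp only [map_mul, MulEquiv.apply_symm_apply] at h1
    exact congrFun h1 ⟨0, hk1⟩
  have hrat := CharacterDegreeRatio.div_le_rat hG hdeg.2 hdeg.1 (by nlinarith)
  push_cast at hrat
  have hlt := (CharacterDegreeRatio.exp_lt_pow_div hq hk).trans_le hrat
  rw [← Real.lt_log_iff_exp_lt ((Real.exp_pos _).trans hlt)] at hlt
  linarith
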